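/- A *quasi-uniformity* on a set $X$ is a filter $\mathscr U$ of reflexive relations on $X$ such that every $U\in\mathscr U$ contains $V\circ V$ for some $V\in\mathscr U$; it generates the topology on $X$ in which $G$ is open iff for every $x\in G$ there is $U\in\mathscr U$ with $\{y:(x,y)\in U\}\subseteq G$, and its conjugate is $\mathscr U^{-1}=\{U^{-1}:U\in\mathscr U\}$. For a topological space $X$, let $\mathscr U_X$ be the universal quasi-uniformity of $X$, i.e. the finest quasi-uniformity on $X$ that generates the topology of $X$, and let $\mathscr U^{\star}$ be the quasi-uniformity on $\mathbb R$ with base $\{(x,y): y<x+r\}$, $r>0$. A *quasi-pseudometric* on $X$ is a function $d:X\times X\to[0,\infty)$ with $d(x,x)=0$ and $d(x,y)\le d(x,z)+d(z,y)$ for all $x,y,z\in X$. We call it *continuous* if it is continuous as a map from $(X\times X,\mathscr U_X^{-1}\times\mathscr U_X)$ to $(\mathbb R,\mathscr U^{\star})$, with respect to the topologies generated by these quasi-uniformities. A subspace $X$ of a topological space $Y$ is *quasi-$P^{*}$-embedded* in $Y$ if every bounded continuous quasi-pseudometric on $X$ is the restriction to $X\times X$ of a continuous quasi-pseudometric on $Y$.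 An Abelian paratopological group is an Abelian group with a topology for which addition is jointly continuous. For a Tychonoff space $X$, the *free Abelian paratopological group* $AP(X)$ is the Abelian paratopological group that contains $X$ as a subspace, is generated by $X$ algebraically, and is such that every continuous map from $X$ to an Abelian paratopological group $H$ extends to a continuous homomorphism $AP(X)\to H$. Equivalently, it is the free Abelian group on $X$ with the finest topology for which addition is jointly continuous and the inclusion of $X$ is continuous. **Theorem.** Let $X$ be an arbitrary subspace of a Tychonoff space $Y$. Then the homomorphism $\hat e_{X,Y}:AP(X)\to AP(Y)$ that extends the inclusion $X\hookrightarrow Y$ is a topological embedding (a homeomorphism onto its image) if and only if $X$ is quasi-$P^{*}$-embedded in $Y$. -/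

import Mathlib

open Filter Topology

/-! ### Quasi-uniformities -/

/-- A quasi-uniformity on `X`: a filter of reflexive relations such that every entourage `U`
contains `V ∘ V` for some entourage `V` (a uniformity without the symmetry axiom). -/
structure QuasiUniformity (X : Type*) where
  entourages : Filter (X × X)
  refl : ∀ U ∈ entourages, ∀ x : X, (x, x) ∈ U
  comp : ∀ U ∈ entourages, ∃ V ∈ entourages, ∀ x y z : X, (x, y) ∈ V → (y, z) ∈ V → (x, z) ∈ U

namespace QuasiUniformity

variable {X Y : Type*}

/-- The topology generated by a quasi-uniformity: `G` is open iff for every `x ∈ G` there is an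
entourage `U` with `U(x) = {y | (x, y) ∈ U} ⊆ G`. -/
@[reducible] def toTopology (𝒰 : QuasiUniformity X) : TopologicalSpace X where
  IsOpen G := ∀ x ∈ G, ∃ U ∈ 𝒰.entourages, {y | (x, y) ∈ U} ⊆ G
  isOpen_univ := fun _ _ => ⟨Set.univ, univ_mem, Set.subset_univ _⟩
  isOpen_inter := by
    rintro G H hG hH x ⟨hxG, hxH⟩
    obtain ⟨U, hU, hUG⟩ := hG x hxG
    obtain ⟨V, hV, hVH⟩ := hH x hxH
    exact ⟨U ∩ V, inter_mem hU hV, fun y hy => ⟨hUG hy.1, hVH hy.2⟩⟩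
  isOpen_sUnion := by
    rintro S hS x ⟨G, hG, hx⟩
    obtain ⟨U, hU, hUG⟩ := hS G hG x hx
    exact ⟨U, hU, fun y hy => ⟨G, hG, hUG hy⟩⟩

theorem nhds_eq_comap (𝒰 : QuasiUniformity X) (x : X) :
    @nhds X 𝒰.toTopology x = comap (Prod.mk x) 𝒰.entourages := by
  let := 𝒰.toTopology
  ext N
  rw [mem_nhds_iff, mem_comap]
  constructor
  · rintro ⟨G, hGN, hG, hx⟩
    obtain ⟨U, hU, hUG⟩ := hG x hx
    exact ⟨U, hU, fun y hy => hGN (hUG hy)⟩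
  · rintro ⟨U, hU, hUN⟩
    refine ⟨{z | ∃ V ∈ 𝒰.entourages, ∀ w, (z, w) ∈ V → w ∈ N}, ?_, ?_, ⟨U, hU, fun w hw => hUN hw⟩⟩
    · rintro z ⟨V, hV, hVN⟩
      exact hVN z (𝒰.refl V hV z)
    · rintro z ⟨V, hV, hVN⟩
      obtain ⟨W, hW, hWV⟩ := 𝒰.comp V hV
      exact ⟨W, hW, fun y hy => ⟨W, hW, fun w hw => hVN w (hWV z y w hy hw)⟩⟩

/-- The conjugate quasi-uniformity `𝒰⁻¹`, consisting of the inverse relations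
`{(y, x) | (x, y) ∈ U}`. -/
def conj (𝒰 : QuasiUniformity X) : QuasiUniformity X where
  entourages := 𝒰.entourages.map Prod.swap
  refl := fun U hU x => 𝒰.refl _ hU x
  comp := by
    intro U hU
    obtain ⟨V, hV, h⟩ := 𝒰.comp _ hU
    refine ⟨Prod.swap ⁻¹' V, ?_, fun x y z hxy hyz => h z y x hyz hxy⟩
    rw [mem_map]
    simpa [← Set.preimage_comp] using hV

/-- The product quasi-uniformity on `X × Y`, generated by the relations
`{((x, y), (x', y')) | (x, x') ∈ U ∧ (y, y') ∈ V}` for entourages `U` and `V`. -/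
def prod (𝒰 : QuasiUniformity X) (𝒱 : QuasiUniformity Y) : QuasiUniformity (X × Y) where
  entourages :=
    comap (fun p : (X × Y) × (X × Y) => ((p.1.1, p.2.1), (p.1.2, p.2.2)))
      (𝒰.entourages ×ˢ 𝒱.entourages)
  refl := by
    rintro S ⟨T, hT, hTS⟩ ⟨x, y⟩
    obtain ⟨U, hU, V, hV, hUV⟩ := mem_prod_iff.1 hT
    exact hTS (hUV ⟨𝒰.refl U hU x, 𝒱.refl V hV y⟩)
  comp := by
    rintro S ⟨T, hT, hTS⟩
    obtain ⟨U, hU, V, hV, hUV⟩ := mem_prod_iff.1 hT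
    obtain ⟨U', hU', hU'U⟩ := 𝒰.comp U hU
    obtain ⟨V', hV', hV'V⟩ := 𝒱.comp V hV
    refine ⟨_, preimage_mem_comap (prod_mem_prod hU' hV'), ?_⟩
    rintro ⟨x, y⟩ ⟨x', y'⟩ ⟨x'', y''⟩ ⟨h₁, h₂⟩ ⟨h₃, h₄⟩
    exact hTS (hUV ⟨hU'U _ _ _ h₁ h₃, hV'V _ _ _ h₂ h₄⟩)

/-- The upper quasi-uniformity on `ℝ`, with base `{(x, y) | y < x + r}`, `r > 0`. -/
def upperReal : QuasiUniformity ℝ where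
  entourages :=
    { sets := {S | ∃ r : ℝ, 0 < r ∧ {p : ℝ × ℝ | p.2 < p.1 + r} ⊆ S}
      univ_sets := ⟨1, one_pos, Set.subset_univ _⟩
      sets_of_superset := fun ⟨r, hr, h⟩ hST => ⟨r, hr, h.trans hST⟩
      inter_sets := by
        rintro S T ⟨r, hr, hS⟩ ⟨s, hs, hT⟩
        refine ⟨min r s, lt_min hr hs, fun p hp => ?_⟩
        have hp' : p.2 < p.1 + min r s := hp
        exact ⟨hS (hp'.trans_le (by gcongr; exact min_le_left r s)),
          hT (hp'.trans_le (by gcongr; exact min_le_right r s))⟩ }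
  refl := by
    rintro S ⟨r, hr, hS⟩ x
    exact hS (lt_add_of_pos_right x hr)
  comp := by
    rintro S ⟨r, hr, hS⟩
    refine ⟨{p : ℝ × ℝ | p.2 < p.1 + r / 2}, ⟨r / 2, half_pos hr, subset_rfl⟩, ?_⟩
    intro x y z hxy hyz
    have h₁ : y < x + r / 2 := hxy
    have h₂ : z < y + r / 2 := hyz
    exact hS (show z < x + r by linarith)

/-- The universal quasi-uniformity of a topological space: the supremum of all quasi-uniformities
that induce the given topology, i.e. the filter generated by all their entourages. By
`universal_toTopology` and `entourages_le_universal` below it is the finest quasi-uniformity that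
induces the given topology. -/
def universal (X : Type*) [t : TopologicalSpace X] : QuasiUniformity X where
  entourages := ⨅ 𝒰 : {𝒰 : QuasiUniformity X // 𝒰.toTopology = t}, 𝒰.1.entourages
  refl := by
    intro U hU x
    have h : pure (x, x) ≤ ⨅ 𝒰 : {𝒰 : QuasiUniformity X // 𝒰.toTopology = t}, 𝒰.1.entourages :=
      le_iInf fun 𝒰 V hV => 𝒰.1.refl V hV x
    exact h hU
  comp := by
    intro U hU
    set F := ⨅ 𝒰 : {𝒰 : QuasiUniformity X // 𝒰.toTopology = t}, 𝒰.1.entourages with hF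
    let c : Set (X × X) → Set (X × X) := fun V => {p | ∃ y, (p.1, y) ∈ V ∧ (y, p.2) ∈ V}
    have hc : Monotone c := fun V W hVW p ⟨y, h₁, h₂⟩ => ⟨y, hVW h₁, hVW h₂⟩
    have h : F.lift' c ≤ F := by
      refine le_iInf fun 𝒰 V hV => ?_
      obtain ⟨W, hW, hWV⟩ := 𝒰.1.comp V hV
      rw [mem_lift'_sets hc]
      exact ⟨W, iInf_le (fun 𝒰 : {𝒰 : QuasiUniformity X // 𝒰.toTopology = t} =>
        𝒰.1.entourages) 𝒰 hW, fun p ⟨y, h₁, h₂⟩ => hWV _ y _ h₁ h₂⟩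
    obtain ⟨V, hV, hVU⟩ := (mem_lift'_sets hc).1 (h hU)
    exact ⟨V, hV, fun x y z h₁ h₂ => hVU ⟨y, h₁, h₂⟩⟩

/-- Every topology is induced by some quasi-uniformity. -/
theorem exists_toTopology_eq (X : Type*) [t : TopologicalSpace X] :
    ∃ 𝒰 : QuasiUniformity X, 𝒰.toTopology = t := by
  let S : {G : Set X // IsOpen G} → Set (X × X) := fun G => {p | p.1 ∈ G.1 → p.2 ∈ G.1}
  let c : Set (X × X) → Set (X × X) := fun V => {p | ∃ y, (p.1, y) ∈ V ∧ (y, p.2) ∈ V}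
  have hc : Monotone c := fun V W hVW p ⟨y, h₁, h₂⟩ => ⟨y, hVW h₁, hVW h₂⟩
  have h : (⨅ G, 𝓟 (S G)).lift' c ≤ ⨅ G, 𝓟 (S G) := by
    refine le_iInf fun G => le_principal_iff.2 ?_
    rw [mem_lift'_sets hc]
    exact ⟨S G, iInf_le (fun G => 𝓟 (S G)) G (mem_principal_self _),
      fun p ⟨y, h₁, h₂⟩ hp => h₂ (h₁ hp)⟩
  let 𝒰 : QuasiUniformity X :=
    { entourages := ⨅ G, 𝓟 (S G)
      refl := fun U hU x => by
        have h : pure (x, x) ≤ ⨅ G, 𝓟 (S G) := le_iInf fun G => by simp [S]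
        exact h hU
      comp := fun U hU => by
        obtain ⟨V, hV, hVU⟩ := (mem_lift'_sets hc).1 (h hU)
        exact ⟨V, hV, fun x y z h₁ h₂ => hVU ⟨y, h₁, h₂⟩⟩ }
  refine ⟨𝒰, TopologicalSpace.ext_nhds fun x => ?_⟩
  rw [nhds_eq_comap]
  change comap (Prod.mk x) (⨅ G, 𝓟 (S G)) = _
  rw [comap_iInf]
  simp only [comap_principal]
  apply le_antisymm
  · intro N hN
    obtain ⟨G, hGN, hG, hx⟩ := mem_nhds_iff.1 hN
    exact iInf_le (fun G => 𝓟 (Prod.mk x ⁻¹' S G)) ⟨G, hG⟩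
      (mem_principal.2 fun y hy => hGN (hy hx))
  · refine le_iInf fun G => le_principal_iff.2 ?_
    by_cases hx : x ∈ G.1
    · exact mem_of_superset (G.2.mem_nhds hx) fun y hy _ => hy
    · exact mem_of_superset univ_mem fun y _ hxG => absurd hxG hx

theorem universal_toTopology (X : Type*) [t : TopologicalSpace X] :
    (universal X).toTopology = t := by
  refine TopologicalSpace.ext_nhds fun x => ?_
  rw [nhds_eq_comap]
  change comap (Prod.mk x)
    (⨅ 𝒰 : {𝒰 : QuasiUniformity X // 𝒰.toTopology = t}, 𝒰.1.entourages) = _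
  rw [comap_iInf]
  obtain ⟨𝒱, h𝒱⟩ := exists_toTopology_eq X
  have : Nonempty {𝒰 : QuasiUniformity X // 𝒰.toTopology = t} := ⟨⟨𝒱, h𝒱⟩⟩
  have h : ∀ 𝒰 : {𝒰 : QuasiUniformity X // 𝒰.toTopology = t},
      comap (Prod.mk x) 𝒰.1.entourages = @nhds X t x := fun 𝒰 => by
    rw [← nhds_eq_comap, 𝒰.2]
  simp only [h, ciInf_const]

/-- A smaller filter of entourages has more entourages, so this says that every quasi-uniformity
inducing the topology is coarser than the universal one. -/
theorem entourages_le_universal {X : Type*} [t : TopologicalSpace X] (𝒰 : QuasiUniformity X)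
    (h : 𝒰.toTopology = t) : (universal X).entourages ≤ 𝒰.entourages :=
  iInf_le (fun 𝒰 : {𝒰 : QuasiUniformity X // 𝒰.toTopology = t} => 𝒰.1.entourages) ⟨𝒰, h⟩

end QuasiUniformity

/-! ### Quasi-pseudometrics and quasi-P*-embedded subspaces -/

/-- A quasi-pseudometric on a set `X`. -/
structure IsQuasiPseudometric {X : Type*} (d : X → X → ℝ) : Prop where
  nonneg : ∀ x y, 0 ≤ d x y
  self : ∀ x, d x x = 0
  triangle : ∀ x y z, d x y ≤ d x z + d z y

/-- `d` is continuous from `(X × X, 𝒰_X⁻¹ × 𝒰_X)` to `(ℝ, 𝒰⋆)`, where `𝒰_X` is the universal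
quasi-uniformity of `X` and `𝒰⋆` is the upper quasi-uniformity. -/
def QuasiContinuous {X : Type*} [TopologicalSpace X] (d : X → X → ℝ) : Prop :=
  Continuous[((QuasiUniformity.universal X).conj.prod (QuasiUniformity.universal X)).toTopology,
    QuasiUniformity.upperReal.toTopology] (fun p : X × X => d p.1 p.2)

/-- The subspace `X` is quasi-P*-embedded in `Y`. -/
def IsQuasiPStarEmbedded {Y : Type*} [TopologicalSpace Y] (X : Set Y) : Prop :=
  ∀ d : X → X → ℝ, IsQuasiPseudometric d → (∃ C : ℝ, ∀ x y, d x y ≤ C) → QuasiContinuous d →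
    ∃ D : Y → Y → ℝ, IsQuasiPseudometric D ∧ QuasiContinuous D ∧
      ∀ x y : X, D (x : Y) (y : Y) = d x y

/-! ### Free Abelian paratopological groups -/

/-- The free Abelian paratopological group `AP(X)`. An Abelian paratopological group is an
`AddCommGroup` with a topology satisfying `ContinuousAdd`. -/
def AP (X : Type*) : Type _ := FreeAbelianGroup X

namespace AP

instance (X : Type*) : AddCommGroup (AP X) := inferInstanceAs (AddCommGroup (FreeAbelianGroup X))

/-- The inclusion of the generators. -/
def of {X : Type*} (x : X) : AP X := FreeAbelianGroup.of x

/-- The homomorphism extending a map defined on the generators. -/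
def lift {X G : Type*} [AddCommGroup G] (f : X → G) : AP X →+ G := FreeAbelianGroup.lift f

@[simp]
theorem lift_of {X G : Type*} [AddCommGroup G] (f : X → G) (x : X) : lift f (of x) = f x :=
  FreeAbelianGroup.lift_apply_of f x

/-- The topology of `AP X`: the finest topology for which addition is jointly continuous and the
inclusion of `X` is continuous (in Mathlib's order on topologies, finer means smaller). -/
instance (X : Type*) [TopologicalSpace X] : TopologicalSpace (AP X) :=
  sInf {t : TopologicalSpace (AP X) |
    @ContinuousAdd (AP X) t _ ∧ @Continuous X (AP X) _ t of}

instance (X : Type*) [TopologicalSpace X] : ContinuousAdd (AP X) :=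
  continuousAdd_sInf fun _ ht => ht.1

theorem continuous_of (X : Type*) [TopologicalSpace X] : Continuous (of : X → AP X) :=
  continuous_sInf_rng.2 fun _ ht => ht.2

/-- The universal property: every continuous map to an Abelian paratopological group extends to a
continuous homomorphism. -/
theorem continuous_lift {X G : Type*} [TopologicalSpace X] [AddCommGroup G] [TopologicalSpace G]
    [ContinuousAdd G] {f : X → G} (hf : Continuous f) : Continuous (lift f : AP X → G) := by
  rw [continuous_iff_le_induced]
  refine sInf_le ⟨continuousAdd_induced (lift f), continuous_induced_rng.2 ?_⟩
  have : (lift f : AP X → G) ∘ of = f := funext fun x => lift_of f x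
  rwa [this]

/-- The generators generate `AP X` algebraically. -/
theorem closure_range_of (X : Type*) : AddSubgroup.closure (Set.range (of : X → AP X)) = ⊤ := by
  rw [eq_top_iff]
  rintro g -
  refine FreeAbelianGroup.induction_on (motive := fun g : FreeAbelianGroup X =>
    (show AP X from g) ∈ AddSubgroup.closure (Set.range (of : X → AP X))) g
    (AddSubgroup.zero_mem _) (fun x => AddSubgroup.subset_closure ⟨x, rfl⟩)
    (fun x h => AddSubgroup.neg_mem _ h) (fun x y hx hy => AddSubgroup.add_mem _ hx hy)

/-- A Tychonoff space `X` is a subspace of `AP X`. -/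
theorem isEmbedding_of (X : Type*) [TopologicalSpace X] [T35Space X] :
    IsEmbedding (of : X → AP X) := by
  refine ⟨⟨le_antisymm (continuous_iff_le_induced.1 (continuous_of X)) ?_⟩,
    FreeAbelianGroup.of_injective⟩
  refine le_of_nhds_le_nhds fun x N hN => ?_
  obtain ⟨G, hGN, hG, hx⟩ := mem_nhds_iff.1 hN
  obtain ⟨f, hf, hfx, hfK⟩ :=
    CompletelyRegularSpace.completely_regular x Gᶜ hG.isClosed_compl (by simpa using hx)
  have hg : Continuous (fun y => (f y : ℝ)) := continuous_subtype_val.comp hf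
  rw [nhds_induced, mem_comap]
  refine ⟨lift (fun y => (f y : ℝ)) ⁻¹' Set.Iio 1,
    (isOpen_Iio.preimage (continuous_lift hg)).mem_nhds ?_, fun y hy => hGN ?_⟩
  · simp [hfx]
  · by_contra hyG
    have h1 : f y = 1 := hfK hyG
    simp [h1] at hy

/-- The natural homomorphism `AP(X) → AP(Y)` extending the inclusion of a subspace `X` of `Y`. -/
def inclusion {Y : Type*} (X : Set Y) : AP X →+ AP Y := lift fun x : X => of (x : Y)

end AP

/-!
The topology of an Abelian paratopological group is described by quasi-prenorms: subadditive
functions `N` with values in `[0, ∞]` and `N 0 = 0`. Kelley's chain lemma works without symmetry, so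
every sequence of neighbourhoods of `0` is controlled by a quasi-prenorm that is continuous at `0`
(`exists_isQuasiPrenorm_of_nhds`). Conversely, a quasi-prenorm on `AP X` is continuous at `0` as soon
as `N (y - x) → 0` when `y → x` in `X` (`AP.tendsto_quasiPrenorm`). On the side of `X`, a
quasi-pseudometric `d` is continuous with respect to the universal quasi-uniformity exactly when
`d x y → 0` as `y → x` for every `x` (`IsQuasiPseudometric.quasiContinuous_iff`). Hence every
continuous quasi-pseudometric `d` on `X` is of the form `N (y - x)` for a quasi-prenorm `N` on `AP X`
that is continuous at `0`, for instance its Graev extension `AP.graev d`; and every such `N` with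
finite values gives a continuous quasi-pseudometric.

If `AP X` is embedded in `AP Y`, a quasi-pseudometric `d ≤ 1` on `X` gives the quasi-prenorm
`N = min (AP.graev d) 1` on `AP X`. The embedding provides a quasi-prenorm `M` on `AP Y`, continuous
at `0`, with `N ≤ M` on `AP X` (`IsQuasiPrenorm.exists_dominating`). Then
`E g = inf_h (N h + M (g - h))` extends `N` and lies below `M`
(`IsQuasiPrenorm.exists_extension`), so that `min (E (y - x)) 1` extends `d` to `Y`. Other bounded
quasi-pseudometrics are handled by scaling.

If `X` is quasi-P*-embedded, a neighbourhood `U` of `0` in `AP X` contains `{M < 1}` for a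
quasi-prenorm `M` continuous at `0`, and the quasi-pseudometric `min (M (y - x)) 1` extends to some
continuous `D` on `Y`. The points outside `X` in a representation of an element of `AP X` as a sum of
differences cancel, and the triangle inequality allows them to be removed without raising the cost;
therefore `min M 1 ≤ AP.graev D` on `AP X` (`AP.le_graev_inclusion`), and `{AP.graev D < 1}` is a
neighbourhood of `0` in `AP Y` that meets `AP X` inside `U`.
-/

open scoped ENNReal

/-! ### Quasi-prenorms on Abelian groups -/

/-- A quasi-prenorm on an Abelian group: a subadditive function vanishing at `0`, with no relation
between the values at `g` and `-g`. Infinite values are allowed. -/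
structure IsQuasiPrenorm {G : Type*} [AddCommGroup G] (N : G → ℝ≥0∞) : Prop where
  zero : N 0 = 0
  add_le : ∀ a b, N (a + b) ≤ N a + N b

namespace IsQuasiPrenorm

variable {G : Type*} [AddCommGroup G] {N : G → ℝ≥0∞}

theorem multiset_sum_le (hN : IsQuasiPrenorm N) {ι : Type*} (f : ι → G) (s : Multiset ι) :
    N (s.map f).sum ≤ (s.map fun i => N (f i)).sum := by
  induction s using Multiset.induction_on with
  | empty => simp [hN.zero]
  | cons a s ih =>
    simp only [Multiset.map_cons, Multiset.sum_cons]
    exact (hN.add_le _ _).trans (by gcongr)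

theorem min_const (hN : IsQuasiPrenorm N) (c : ℝ≥0∞) : IsQuasiPrenorm fun g => min (N g) c where
  zero := by simp [hN.zero]
  add_le a b := by
    rcases le_total (N a) c with ha | ha
    · rcases le_total (N b) c with hb | hb
      · rw [min_eq_left ha, min_eq_left hb]
        exact (min_le_left _ _).trans (hN.add_le a b)
      · rw [min_eq_right hb]
        exact (min_le_right _ _).trans le_add_self
    · rw [min_eq_right ha]
      exact (min_le_right _ _).trans le_self_add

/-- A finite quasi-prenorm on `G` and a map `f : X → G` give a quasi-pseudometric on `X`. -/
theorem isQuasiPseudometric (hN : IsQuasiPrenorm N) (hfin : ∀ g, N g ≠ ∞) {X : Type*}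
    (f : X → G) : IsQuasiPseudometric fun x y => (N (f y - f x)).toReal where
  nonneg _ _ := ENNReal.toReal_nonneg
  self x := by simp [hN.zero]
  triangle x y z := by
    rw [← ENNReal.toReal_add (hfin _) (hfin _)]
    refine ENNReal.toReal_mono (ENNReal.add_ne_top.2 ⟨hfin _, hfin _⟩) ?_
    have h : f y - f x = (f z - f x) + (f y - f z) := by abel
    rw [h]
    exact hN.add_le _ _

/-- A quasi-prenorm on `H` that is dominated by the restriction of a quasi-prenorm on `G` along a
homomorphism `φ : H → G` extends along `φ` to a quasi-prenorm on `G` with the same bound. -/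
theorem exists_extension {H : Type*} [AddCommGroup H] {N : H → ℝ≥0∞} (hN : IsQuasiPrenorm N)
    {M : G → ℝ≥0∞} (hM : IsQuasiPrenorm M) (φ : H →+ G) (hNM : ∀ h, N h ≤ M (φ h)) :
    ∃ E : G → ℝ≥0∞, IsQuasiPrenorm E ∧ (∀ g, E g ≤ M g) ∧ ∀ h, E (φ h) = N h := by
  have hle : ∀ g, ⨅ h, N h + M (g - φ h) ≤ M g := fun g =>
    iInf_le_of_le 0 (by simp [hN.zero])
  refine ⟨fun g => ⨅ h, N h + M (g - φ h), ⟨?_, fun a b => ?_⟩, hle, fun h => ?_⟩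
  · exact le_antisymm ((hle 0).trans_eq hM.zero) zero_le
  · rw [ENNReal.iInf_add]
    refine le_iInf fun h => ?_
    rw [ENNReal.add_iInf]
    refine le_iInf fun k => iInf_le_of_le (h + k) ?_
    have e : a + b - φ (h + k) = (a - φ h) + (b - φ k) := by rw [map_add]; abel
    calc N (h + k) + M (a + b - φ (h + k))
        ≤ (N h + N k) + (M (a - φ h) + M (b - φ k)) := by
          rw [e]
          exact add_le_add (hN.add_le _ _) (hM.add_le _ _)
      _ = N h + M (a - φ h) + (N k + M (b - φ k)) := by ring
  · refine le_antisymm (iInf_le_of_le h (by simp [hM.zero])) (le_iInf fun k => ?_)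
    calc N h = N (k + (h - k)) := by rw [add_sub_cancel]
      _ ≤ N k + N (h - k) := hN.add_le _ _
      _ ≤ N k + M (φ h - φ k) := by
          rw [← map_sub]
          gcongr
          exact hNM _

end IsQuasiPrenorm

/-- The largest quasi-prenorm `N` with `N (v i) ≤ c i` for all `i`: the least total cost of writing
an element as a finite sum of the `v i` with repetitions. It is `∞` off the submonoid that they
generate. -/
noncomputable def chainNorm {G ι : Type*} [AddCommGroup G] (v : ι → G) (c : ι → ℝ≥0∞) (g : G) :
    ℝ≥0∞ :=
  ⨅ s : {s : Multiset ι // (s.map v).sum = g}, (s.1.map c).sum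

section chainNorm

variable {G ι : Type*} [AddCommGroup G] (v : ι → G) (c : ι → ℝ≥0∞)

theorem chainNorm_sum_le (s : Multiset ι) : chainNorm v c (s.map v).sum ≤ (s.map c).sum :=
  iInf_le_of_le ⟨s, rfl⟩ le_rfl

theorem chainNorm_le (i : ι) : chainNorm v c (v i) ≤ c i := by
  simpa using chainNorm_sum_le v c {i}

theorem isQuasiPrenorm_chainNorm : IsQuasiPrenorm (chainNorm v c) where
  zero := le_antisymm (by simpa using chainNorm_sum_le v c 0) zero_le
  add_le a b := by
    conv_rhs => rw [chainNorm, ENNReal.iInf_add]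
    refine le_iInf fun ⟨s, hs⟩ => ?_
    conv_rhs => rw [chainNorm, ENNReal.add_iInf]
    refine le_iInf fun ⟨t, ht⟩ => ?_
    have h := chainNorm_sum_le v c (s + t)
    simpa [hs, ht] using h

end chainNorm

/-! ### Quasi-prenorms from sequences of neighbourhoods -/

/-- A nonempty list of weight less than `r + r'` splits at some entry into an initial part of weight
less than `r` and a final part of weight less than `r'`; `a` is weight already spent on the left. -/
theorem List.exists_split_of_sum_lt {ι : Type*} (c : ι → ℝ≥0∞) {r r' : ℝ≥0∞} (hr' : 0 < r') :
    ∀ (l : List ι) (a : ℝ≥0∞), l ≠ [] → a < r → a + (l.map c).sum < r + r' →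
      ∃ l₁ i l₂, l = l₁ ++ i :: l₂ ∧ a + (l₁.map c).sum < r ∧ (l₂.map c).sum < r' := by
  intro l
  induction l with
  | nil => intro a h; exact absurd rfl h
  | cons i l ih =>
    intro a _ ha hsum
    rcases lt_or_ge (l.map c).sum r' with hl | hl
    · exact ⟨[], i, l, rfl, by simpa using ha, hl⟩
    · rw [List.map_cons, List.sum_cons, ← add_assoc] at hsum
      have hai : a + c i < r := by
        by_contra! h
        exact absurd hsum (not_lt.2 (add_le_add h hl))
      have hne : l ≠ [] := by
        rintro rfl
        simp at hl
        exact hr'.ne' hl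
      obtain ⟨l₁, j, l₂, rfl, h₁, h₂⟩ := ih (a + c i) hne hai hsum
      exact ⟨i :: l₁, j, l₂, rfl, by simpa [add_assoc] using h₁, h₂⟩

/-- Kelley's chain lemma without symmetry. The middle term of the split below has weight less than
`2⁻ⁿ`, hence at most `2⁻⁽ⁿ⁺¹⁾`, so all three parts lie in `V (n + 1)`. -/
theorem sum_mem_of_sum_weight_lt {G : Type*} [AddCommGroup G] {V : ℕ → Set G}
    (h0 : ∀ n, (0 : G) ∈ V n)
    (hV : ∀ n, ∀ a ∈ V (n + 1), ∀ b ∈ V (n + 1), ∀ d ∈ V (n + 1), a + b + d ∈ V n)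
    (n : ℕ) (l : List (Σ n, V n)) (hl : (l.map fun i => (2⁻¹ : ℝ≥0∞) ^ i.1).sum < 2⁻¹ ^ n) :
    (l.map fun i => (i.2 : G)).sum ∈ V n := by
  have hanti : Antitone V := antitone_nat_of_succ_le fun n a ha => by
    simpa using hV n a ha 0 (h0 _) 0 (h0 _)
  induction hk : l.length using Nat.strong_induction_on generalizing l n with
  | _ k ih =>
    subst hk
    rcases eq_or_ne l [] with rfl | hne
    · simpa using h0 n
    have hpos : (0 : ℝ≥0∞) < 2⁻¹ ^ (n + 1) := ENNReal.pow_pos (by simp) _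
    have htwo : (2⁻¹ : ℝ≥0∞) ^ (n + 1) + 2⁻¹ ^ (n + 1) = 2⁻¹ ^ n := by
      rw [pow_succ, ← mul_add, ENNReal.inv_two_add_inv_two, mul_one]
    obtain ⟨l₁, i, l₂, rfl, h₁, h₂⟩ :=
      List.exists_split_of_sum_lt (fun i : Σ n, V n => (2⁻¹ : ℝ≥0∞) ^ i.1) hpos l 0 hne hpos
        (by rwa [zero_add, htwo])
    rw [zero_add] at h₁
    have hi : n < i.1 := by
      by_contra! h
      refine absurd hl (not_lt.2 ?_)
      calc (2⁻¹ : ℝ≥0∞) ^ n ≤ 2⁻¹ ^ i.1 := pow_le_pow_right_of_le_one' (by simp) h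
        _ ≤ _ := by
          simp only [List.map_append, List.map_cons, List.sum_append, List.sum_cons]
          exact le_self_add.trans le_add_self
    have e₁ := ih l₁.length (by simp) (n + 1) l₁ h₁ rfl
    have e₂ := ih l₂.length (by simp; omega) (n + 1) l₂ h₂ rfl
    have := hV n _ e₁ _ (hanti (Nat.succ_le_of_lt hi) i.2.2) _ e₂
    simpa [add_assoc] using this

/-- In an Abelian paratopological group, every sequence of neighbourhoods of `0` is controlled by a
quasi-prenorm that is continuous at `0`. -/
theorem exists_isQuasiPrenorm_of_nhds {G : Type*} [AddCommGroup G] [TopologicalSpace G]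
    [ContinuousAdd G] (U : ℕ → Set G) (hU : ∀ n, U n ∈ 𝓝 (0 : G)) :
    ∃ M : G → ℝ≥0∞, IsQuasiPrenorm M ∧ Tendsto M (𝓝 0) (𝓝 0) ∧
      ∀ n g, M g < 2⁻¹ ^ n → g ∈ U n := by
  have step : ∀ (n : ℕ) (W : {W : Set G // W ∈ 𝓝 0}), ∃ W' : {W : Set G // W ∈ 𝓝 0},
      W'.1 ⊆ U (n + 1) ∧ ∀ a ∈ W'.1, ∀ b ∈ W'.1, ∀ d ∈ W'.1, a + b + d ∈ W.1 := by
    rintro n ⟨W, hW⟩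
    obtain ⟨V, hV, h⟩ := exists_nhds_zero_quarter hW
    refine ⟨⟨V ∩ U (n + 1), inter_mem hV (hU _)⟩, Set.inter_subset_right, ?_⟩
    intro a ha b hb d hd
    simpa using h ha.1 hb.1 hd.1 (mem_of_mem_nhds hV)
  choose f hfU hf using step
  let V : ℕ → {W : Set G // W ∈ 𝓝 0} := fun n => Nat.rec ⟨U 0, hU 0⟩ f n
  have hVU : ∀ n, (V n).1 ⊆ U n
    | 0 => subset_rfl
    | n + 1 => hfU n (V n)
  let v : (Σ n, (V n).1) → G := fun i => i.2
  let c : (Σ n, (V n).1) → ℝ≥0∞ := fun i => 2⁻¹ ^ i.1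
  refine ⟨chainNorm v c, isQuasiPrenorm_chainNorm v c, ?_, fun n g hg => hVU n ?_⟩
  · rw [ENNReal.tendsto_nhds_zero]
    intro ε hε
    obtain ⟨n, hn⟩ := ENNReal.exists_inv_two_pow_lt hε.ne'
    filter_upwards [(V n).2] with g hg
    exact (chainNorm_le v c ⟨n, g, hg⟩).trans hn.le
  · obtain ⟨⟨s, rfl⟩, hs⟩ := iInf_lt_iff.1 hg
    induction s using Quotient.inductionOn with
    | h l =>
      have := sum_mem_of_sum_weight_lt (V := fun n => (V n).1)
        (fun n => mem_of_mem_nhds (V n).2) (fun n => hf n (V n)) n l (by simpa [c] using hs)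
      simpa [v] using this

/-- If `φ : H → G` induces the topology of `H` at `0`, then a quasi-prenorm on `H` with values at
most `1` that is continuous at `0` is dominated by the restriction of one on `G`. -/
theorem IsQuasiPrenorm.exists_dominating {G H : Type*} [AddCommGroup G] [TopologicalSpace G]
    [ContinuousAdd G] [AddCommGroup H] [TopologicalSpace H] (φ : H →+ G)
    (hφ : comap φ (𝓝 0) ≤ 𝓝 0) {N : H → ℝ≥0∞} (hN1 : ∀ h, N h ≤ 1)
    (hN : Tendsto N (𝓝 0) (𝓝 0)) :
    ∃ M : G → ℝ≥0∞, IsQuasiPrenorm M ∧ Tendsto M (𝓝 0) (𝓝 0) ∧ ∀ h, N h ≤ M (φ h) := by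
  have key : ∀ n : ℕ, ∃ U ∈ 𝓝 (0 : G), ∀ h, φ h ∈ U → N h < 2⁻¹ ^ (n + 1) := by
    intro n
    have : {h | N h < 2⁻¹ ^ (n + 1)} ∈ 𝓝 (0 : H) :=
      hN (Iio_mem_nhds (ENNReal.pow_pos (by simp) _))
    obtain ⟨U, hU, hUN⟩ := mem_comap.1 (hφ this)
    exact ⟨U, hU, fun h hh => hUN hh⟩
  choose U hU hUN using key
  obtain ⟨M, hM, hM0, hMU⟩ := exists_isQuasiPrenorm_of_nhds U hU
  refine ⟨M, hM, hM0, fun h => ?_⟩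
  by_contra! hlt
  have hex : ∃ n : ℕ, (2⁻¹ : ℝ≥0∞) ^ (n + 1) < N h := by
    obtain ⟨n, hn⟩ := ENNReal.exists_inv_two_pow_lt hlt.ne_bot
    exact ⟨n, (pow_le_pow_right_of_le_one' (by simp) n.le_succ).trans_lt hn⟩
  classical
  -- For the least such `n`, both `N h ≤ 2⁻ⁿ` and `2⁻⁽ⁿ⁺¹⁾ < N h` hold.
  have hn := Nat.find_spec hex
  have hn' : N h ≤ 2⁻¹ ^ Nat.find hex := by
    rcases hk : Nat.find hex with _ | k
    · simpa using hN1 h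
    · exact not_lt.1 (Nat.find_min hex (by omega))
  exact (hUN _ h (hMU _ _ (hlt.trans_le hn'))).not_gt hn

/-! ### Continuous quasi-pseudometrics -/

/-- The entourages `{(x, y) | d x y < r}` can be added to the universal quasi-uniformity without
changing its topology, hence already belong to it. -/
theorem IsQuasiPseudometric.mem_universal {X : Type*} [t : TopologicalSpace X] {d : X → X → ℝ}
    (hd : IsQuasiPseudometric d) (h : ∀ x, Tendsto (d x) (𝓝 x) (𝓝 0)) {r : ℝ} (hr : 0 < r) :
    {p : X × X | d p.1 p.2 < r} ∈ (QuasiUniformity.universal X).entourages := by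
  let F : Filter (X × X) := comap (fun p : X × X => d p.1 p.2) (𝓝 0)
  have hF : ∀ S, S ∈ F ↔ ∃ ε > 0, {p : X × X | d p.1 p.2 < ε} ⊆ S := by
    intro S
    rw [((nhds_basis_Ioo_pos (0 : ℝ)).comap _).mem_iff]
    refine exists_congr fun ε => and_congr_right fun hε => ?_
    have e : (fun p : X × X => d p.1 p.2) ⁻¹' Set.Ioo (0 - ε) (0 + ε) = {p | d p.1 p.2 < ε} := by
      ext p
      have := hd.nonneg p.1 p.2
      simp only [Set.mem_preimage, Set.mem_Ioo, Set.mem_ofPred_eq, zero_sub, zero_add]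
      exact ⟨fun h => h.2, fun h => ⟨by linarith, h⟩⟩
    rw [e]
  let 𝒰 := QuasiUniformity.universal X
  let 𝒱 : QuasiUniformity X :=
    { entourages := 𝒰.entourages ⊓ F
      refl := by
        intro S hS x
        obtain ⟨A, hA, B, hB, rfl⟩ := mem_inf_iff.1 hS
        obtain ⟨ε, hε, hB⟩ := (hF B).1 hB
        exact ⟨𝒰.refl A hA x, hB (by simpa [hd.self] using hε)⟩
      comp := by
        intro S hS
        obtain ⟨A, hA, B, hB, rfl⟩ := mem_inf_iff.1 hS
        obtain ⟨ε, hε, hB⟩ := (hF B).1 hB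
        obtain ⟨A', hA', hA⟩ := 𝒰.comp A hA
        refine ⟨A' ∩ {p | d p.1 p.2 < ε / 2},
          inter_mem_inf hA' ((hF _).2 ⟨ε / 2, half_pos hε, subset_rfl⟩), ?_⟩
        rintro x y z ⟨h₁, h₂⟩ ⟨h₃, h₄⟩
        refine ⟨hA x y z h₁ h₃, hB ?_⟩
        simp only [Set.mem_ofPred_eq] at h₂ h₄ ⊢
        linarith [hd.triangle x z y] }
  have h𝒱 : 𝒱.toTopology = t := by
    refine TopologicalSpace.ext_nhds fun x => ?_
    rw [QuasiUniformity.nhds_eq_comap]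
    change comap (Prod.mk x) (𝒰.entourages ⊓ comap (fun p : X × X => d p.1 p.2) (𝓝 0)) = _
    rw [comap_inf, ← QuasiUniformity.nhds_eq_comap, QuasiUniformity.universal_toTopology,
      comap_comap]
    exact inf_eq_left.2 (h x).le_comap
  refine QuasiUniformity.entourages_le_universal 𝒱 h𝒱 ?_
  exact mem_inf_of_right ((hF _).2 ⟨r, hr, subset_rfl⟩)

/-- For a quasi-pseudometric, continuity with respect to the universal quasi-uniformity reduces to
topological continuity of each `d x` at the single point `x`. -/
theorem IsQuasiPseudometric.quasiContinuous_iff {X : Type*} [t : TopologicalSpace X]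
    {d : X → X → ℝ} (hd : IsQuasiPseudometric d) :
    QuasiContinuous d ↔ ∀ x, Tendsto (d x) (𝓝 x) (𝓝 0) := by
  let 𝒬 := (QuasiUniformity.universal X).conj.prod (QuasiUniformity.universal X)
  have hcont : QuasiContinuous d ↔ ∀ p : X × X, ∀ r : ℝ, 0 < r →
      {q : X × X | d q.1 q.2 < d p.1 p.2 + r} ∈ comap (Prod.mk p) 𝒬.entourages := by
    rw [QuasiContinuous, @continuous_iff_continuousAt _ _ 𝒬.toTopology
      QuasiUniformity.upperReal.toTopology]
    refine forall_congr' fun p => ?_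
    unfold ContinuousAt
    rw [QuasiUniformity.nhds_eq_comap, QuasiUniformity.nhds_eq_comap]
    constructor
    · intro h r hr
      exact h ⟨{p : ℝ × ℝ | p.2 < p.1 + r}, ⟨r, hr, subset_rfl⟩, fun _ h => h⟩
    · rintro h S ⟨T, ⟨r, hr, hrT⟩, hTS⟩
      exact mem_of_superset (h r hr) fun q hq => hTS (hrT hq)
  rw [hcont]
  constructor
  · intro h x
    rw [(nhds_basis_Ioo_pos (0 : ℝ)).tendsto_right_iff]
    intro r hr
    obtain ⟨S, ⟨T, hT, hTS⟩, hS⟩ := h (x, x) r hr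
    obtain ⟨U, hU, V, hV, hUV⟩ := mem_prod_iff.1 hT
    have hx : {y | (x, y) ∈ V} ∈ 𝓝 x := by
      have := preimage_mem_comap (m := Prod.mk x) hV
      rwa [← QuasiUniformity.nhds_eq_comap, QuasiUniformity.universal_toTopology] at this
    filter_upwards [hx] with y hy
    have hlt : d x y < d x x + r :=
      hS (a := (x, y)) (hTS (hUV ⟨(QuasiUniformity.universal X).conj.refl U hU x, hy⟩))
    rw [hd.self] at hlt
    exact ⟨by linarith [hd.nonneg x y], hlt⟩
  · rintro h ⟨x, y⟩ r hr
    have hU := hd.mem_universal h (half_pos hr)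
    refine ⟨_, preimage_mem_comap (prod_mem_prod (s := Prod.swap ⁻¹' {p | d p.1 p.2 < r / 2})
      ?_ hU), ?_⟩
    · rw [QuasiUniformity.conj, mem_map]
      exact hU
    · rintro ⟨x', y'⟩ ⟨h₁, h₂⟩
      change d x' x < r / 2 at h₁
      change d y y' < r / 2 at h₂
      change d x' y' < d x y + r
      linarith [hd.triangle x' y' x, hd.triangle x y' y]

/-! ### Continuity in free Abelian paratopological groups -/

namespace AP

/-- A quasi-prenorm `N` on `AP X` defines a group topology with continuous addition, so it is
continuous at `0` as soon as `X` maps continuously into that topology. -/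
theorem tendsto_quasiPrenorm {X : Type*} [TopologicalSpace X] {N : AP X → ℝ≥0∞}
    (hN : IsQuasiPrenorm N) (h : ∀ x, Tendsto (fun y => N (of y - of x)) (𝓝 x) (𝓝 0)) :
    Tendsto N (𝓝 0) (𝓝 0) := by
  have hF : ∀ S, S ∈ comap (fun p : AP X × AP X => N (p.2 - p.1)) (𝓝 0) ↔
      ∃ ε > 0, {p : AP X × AP X | N (p.2 - p.1) < ε} ⊆ S := by
    intro S
    rw [(ENNReal.nhds_zero_basis.comap _).mem_iff]
    rfl
  let 𝒰 : QuasiUniformity (AP X) :=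
    { entourages := comap (fun p : AP X × AP X => N (p.2 - p.1)) (𝓝 0)
      refl := by
        intro S hS x
        obtain ⟨ε, hε, hS⟩ := (hF S).1 hS
        exact hS (by simpa [hN.zero] using hε)
      comp := by
        intro S hS
        obtain ⟨ε, hε, hS⟩ := (hF S).1 hS
        refine ⟨_, (hF _).2 ⟨ε / 2, ENNReal.half_pos hε.ne', subset_rfl⟩, ?_⟩
        intro x y z hxy hyz
        refine hS ?_
        change N (z - x) < ε
        have e : z - x = (y - x) + (z - y) := by abel
        rw [e, ← ENNReal.add_halves ε]
        exact (hN.add_le _ _).trans_lt (ENNReal.add_lt_add hxy hyz) }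
  have hnhds : ∀ g, @nhds _ 𝒰.toTopology g = comap (fun k => N (k - g)) (𝓝 0) := by
    intro g
    rw [QuasiUniformity.nhds_eq_comap]
    exact comap_comap
  have hadd : @ContinuousAdd (AP X) 𝒰.toTopology _ := by
    let _ := 𝒰.toTopology
    refine ⟨continuous_iff_continuousAt.2 fun ⟨a, b⟩ => ?_⟩
    rw [ContinuousAt, nhds_prod_eq, hnhds (a + b), hnhds a, hnhds b, tendsto_comap_iff]
    have hlim : Tendsto (fun p : AP X × AP X => N (p.1 - a) + N (p.2 - b))
        (comap (fun k => N (k - a)) (𝓝 0) ×ˢ comap (fun k => N (k - b)) (𝓝 0)) (𝓝 0) := by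
      have h₁ : Tendsto (fun k => N (k - a)) (comap (fun k => N (k - a)) (𝓝 0)) (𝓝 0) :=
        tendsto_comap
      have h₂ : Tendsto (fun k => N (k - b)) (comap (fun k => N (k - b)) (𝓝 0)) (𝓝 0) :=
        tendsto_comap
      simpa using (h₁.comp tendsto_fst).add (h₂.comp tendsto_snd)
    refine tendsto_of_tendsto_of_tendsto_of_le_of_le tendsto_const_nhds hlim
      (fun _ => zero_le) fun p => ?_
    have e : p.1 + p.2 - (a + b) = (p.1 - a) + (p.2 - b) := by abel
    change N (p.1 + p.2 - (a + b)) ≤ _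
    rw [e]
    exact hN.add_le _ _
  have hof : @Continuous X (AP X) _ 𝒰.toTopology of := by
    let _ := 𝒰.toTopology
    refine continuous_iff_continuousAt.2 fun x => ?_
    rw [ContinuousAt, hnhds, tendsto_comap_iff]
    exact h x
  have hle : (inferInstance : TopologicalSpace (AP X)) ≤ 𝒰.toTopology := sInf_le ⟨hadd, hof⟩
  have h0 := hnhds 0
  simp only [sub_zero] at h0
  exact tendsto_iff_comap.2 ((nhds_mono hle).trans_eq h0)

/-- The Graev extension of a quasi-pseudometric `d` on `X`: the largest quasi-prenorm on `AP X` whose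
value at `y - x` is at most `d x y` for all generators `x`, `y`. It is infinite on the elements
whose coefficients do not add up to `0`. -/
noncomputable def graev {X : Type*} (d : X → X → ℝ) : AP X → ℝ≥0∞ :=
  chainNorm (fun p : X × X => of p.2 - of p.1) fun p => ENNReal.ofReal (d p.1 p.2)

theorem isQuasiPrenorm_graev {X : Type*} (d : X → X → ℝ) : IsQuasiPrenorm (graev d) :=
  isQuasiPrenorm_chainNorm _ _

theorem graev_sub_le {X : Type*} (d : X → X → ℝ) (x y : X) :
    graev d (of y - of x) ≤ ENNReal.ofReal (d x y) :=
  chainNorm_le (fun p : X × X => of p.2 - of p.1) (fun p => ENNReal.ofReal (d p.1 p.2)) (x, y)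

/-- The lower bound comes from the homomorphism to `ℝ` that extends `d x`, which increases by at
most `d a b` along `b - a`. -/
theorem graev_sub {X : Type*} {d : X → X → ℝ} (hd : IsQuasiPseudometric d) (x y : X) :
    graev d (of y - of x) = ENNReal.ofReal (d x y) := by
  refine le_antisymm (graev_sub_le d x y) (le_iInf fun ⟨s, hs⟩ => ?_)
  have hprenorm : IsQuasiPrenorm fun g : AP X => ENNReal.ofReal (lift (d x) g) :=
    ⟨by simp, fun a b => by rw [map_add]; exact ENNReal.ofReal_add_le⟩
  have := hprenorm.multiset_sum_le (fun p : X × X => of p.2 - of p.1) s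
  rw [hs] at this
  simp only [map_sub, lift_of, hd.self, sub_zero] at this
  refine this.trans (Multiset.sum_map_le_sum_map _ _ fun p _ => ENNReal.ofReal_le_ofReal ?_)
  linarith [hd.triangle x p.2 p.1]

theorem tendsto_graev {X : Type*} [TopologicalSpace X] {d : X → X → ℝ}
    (h : ∀ x, Tendsto (d x) (𝓝 x) (𝓝 0)) : Tendsto (graev d) (𝓝 0) (𝓝 0) := by
  refine tendsto_quasiPrenorm (isQuasiPrenorm_graev d) fun x => ?_
  have : Tendsto (fun y => ENNReal.ofReal (d x y)) (𝓝 x) (𝓝 0) := by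
    simpa using ENNReal.tendsto_ofReal (h x)
  exact tendsto_of_tendsto_of_tendsto_of_le_of_le tendsto_const_nhds this
    (fun _ => zero_le) fun y => graev_sub_le d x y

/-- Pulling a quasi-prenorm that is continuous at `0` back to the generators gives a continuous
quasi-pseudometric. -/
theorem tendsto_toReal_sub {X : Type*} [TopologicalSpace X] {N : AP X → ℝ≥0∞}
    (hN : Tendsto N (𝓝 0) (𝓝 0)) (x : X) :
    Tendsto (fun y : X => (N (of y - of x)).toReal) (𝓝 x) (𝓝 0) := by
  have h : Tendsto (fun y : X => of y - of x) (𝓝 x) (𝓝 (0 : AP X)) := by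
    have := ((continuous_of X).tendsto x).add_const (-of x)
    simpa only [← sub_eq_add_neg, sub_self] using this
  exact (ENNReal.tendsto_toReal ENNReal.zero_ne_top).comp (hN.comp h)

/-! ### The inclusion of a subspace -/

variable {Y : Type*} (X : Set Y)

@[simp]
theorem inclusion_of (x : X) : inclusion X (of x) = of (x : Y) := lift_of _ x

theorem hom_ext {Z G : Type*} [AddCommGroup G] {f g : AP Z →+ G} (h : ∀ z, f (of z) = g (of z)) :
    f = g :=
  FreeAbelianGroup.lift_ext _ _ h

open scoped Classical in
/-- The left inverse of the inclusion `AP X → AP Y` that kills the generators outside `X`. -/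
noncomputable def restrict : AP Y →+ AP X := lift fun y => if h : y ∈ X then of ⟨y, h⟩ else 0

theorem restrict_of {y : Y} (h : y ∈ X) : restrict X (of y) = of ⟨y, h⟩ := by
  simp [restrict, h]

theorem restrict_inclusion (g : AP X) : restrict X (inclusion X g) = g := by
  have : (restrict X).comp (inclusion X) = AddMonoidHom.id _ :=
    hom_ext fun x => by simp [restrict_of X x.2]
  exact DFunLike.congr_fun this g

theorem continuous_inclusion [TopologicalSpace Y] : Continuous (inclusion X) :=
  continuous_lift ((continuous_of Y).comp continuous_subtype_val)

/-- Translations are homeomorphisms in any group with continuous addition, so it is enough to compare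
neighbourhoods of `0`. -/
theorem isEmbedding_inclusion_iff [TopologicalSpace Y] :
    IsEmbedding (inclusion X) ↔ comap (inclusion X) (𝓝 0) ≤ 𝓝 0 := by
  constructor
  · intro h
    rw [h.isInducing.nhds_eq_comap, map_zero]
  · intro h
    refine ⟨isInducing_iff_nhds.2 fun g => le_antisymm
      ((continuous_inclusion X).tendsto g).le_comap ?_,
      Function.LeftInverse.injective (restrict_inclusion X)⟩
    have e₁ : 𝓝 g = comap (fun k => -g + k) (𝓝 0) := by
      simpa using ((Homeomorph.addLeft (-g)).isInducing.nhds_eq_comap g)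
    have e₂ : 𝓝 (inclusion X g) = comap (fun k => -inclusion X g + k) (𝓝 0) := by
      simpa using ((Homeomorph.addLeft (-inclusion X g)).isInducing.nhds_eq_comap (inclusion X g))
    rw [e₁, e₂, comap_comap]
    have e₃ : (fun k => -inclusion X g + k) ∘ inclusion X = inclusion X ∘ fun k => -g + k := by
      ext k
      simp
    rw [e₃, ← comap_comap]
    exact comap_mono h

/-- The Graev extension of `D` bounds a quasi-prenorm on the subgroup `AP X` that is bounded by `D`
on differences of generators. A representation of an element of `AP X` that uses points outside
`X` is shortened: if `(x, y)` occurs with `y ∉ X`, then `y` has to cancel, so some `(y, z)` occurs,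
and the two pairs can be replaced by `(x, z)`. -/
theorem le_graev_inclusion {D : Y → Y → ℝ} (hD : IsQuasiPseudometric D) {M : AP X → ℝ≥0∞}
    (hM : IsQuasiPrenorm M)
    (hMD : ∀ x y : X, M (of y - of x) ≤ ENNReal.ofReal (D x y)) (h : AP X) :
    M h ≤ graev D (inclusion X h) := by
  classical
  refine le_iInf fun ⟨s, hs⟩ => ?_
  dsimp only
  induction hk : s.card using Nat.strong_induction_on generalizing s with
  | _ k ih =>
  subst hk
  -- The coefficient of a generator outside `X`.
  let φ : Y → AP Y →+ ℤ := fun y => lift fun z => if z = y then 1 else 0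
  have hφ : ∀ y z, φ y (of z) = if z = y then 1 else 0 := fun y z => lift_of _ z
  have hφh : ∀ y ∉ X, φ y (inclusion X h) = 0 := by
    intro y hy
    have : (φ y).comp (inclusion X) = 0 := hom_ext fun x => by
      have : (x : Y) ≠ y := fun e => hy (e ▸ x.2)
      simp [hφ, this]
    exact DFunLike.congr_fun this h
  by_cases hsnd : ∃ p ∈ s, p.2 ∉ X
  · obtain ⟨⟨x, y⟩, hp, hy⟩ := hsnd
    obtain ⟨s, rfl⟩ := Multiset.exists_cons_of_mem hp
    simp only [Multiset.map_cons, Multiset.sum_cons] at hs ⊢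
    by_cases hxy : x = y
    · subst hxy
      refine (ih s.card (by simp) s (by simpa using hs) rfl).trans le_add_self
    · have hex : ∃ q ∈ s, q.1 = y := by
        by_contra! hno
        have h0 := congrArg (φ y) hs
        rw [hφh y hy, map_add, map_sub, hφ, hφ, if_pos rfl, if_neg hxy, map_multiset_sum,
          Multiset.map_map] at h0
        have : 0 ≤ (s.map ((φ y) ∘ fun p => of p.2 - of p.1)).sum := by
          refine Multiset.sum_nonneg fun a ha => ?_
          obtain ⟨q, hq, rfl⟩ := Multiset.mem_map.1 ha
          simp only [Function.comp_apply, map_sub, hφ, if_neg (hno q hq)]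
          split_ifs <;> simp
        linarith
      obtain ⟨⟨_, z⟩, hq, rfl⟩ := hex
      rename_i y
      obtain ⟨s, rfl⟩ := Multiset.exists_cons_of_mem hq
      simp only [Multiset.map_cons, Multiset.sum_cons] at hs ⊢
      have := ih ((x, z) ::ₘ s).card (by simp) ((x, z) ::ₘ s)
        (by
          simp only [Multiset.map_cons, Multiset.sum_cons]
          rw [← hs]
          abel) rfl
      refine this.trans ?_
      simp only [Multiset.map_cons, Multiset.sum_cons]
      rw [← add_assoc, ← ENNReal.ofReal_add (hD.nonneg _ _) (hD.nonneg _ _)]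
      gcongr
      exact hD.triangle _ _ _
  · push Not at hsnd
    -- A first entry outside `X` could only cancel against a second entry outside `X`.
    have hfst : ∀ p ∈ s, p.1 ∈ X := by
      intro p hp
      by_contra hpX
      have h0 := congrArg (φ p.1) hs
      obtain ⟨s, rfl⟩ := Multiset.exists_cons_of_mem hp
      have hne : ∀ q ∈ p ::ₘ s, q.2 ≠ p.1 := fun q hq e => hpX (e ▸ hsnd q hq)
      rw [hφh p.1 hpX, Multiset.map_cons, Multiset.sum_cons, map_add, map_sub, hφ, hφ, if_pos rfl,
        if_neg (hne p (Multiset.mem_cons_self p s)), map_multiset_sum, Multiset.map_map] at h0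
      have : (s.map ((φ p.1) ∘ fun p => of p.2 - of p.1)).sum ≤ 0 := by
        rw [← Multiset.sum_map_zero (m := s)]
        refine Multiset.sum_map_le_sum_map _ _ fun q hq => ?_
        simp only [Function.comp_apply, map_sub, hφ,
          if_neg (hne q (Multiset.mem_cons_of_mem hq))]
        split_ifs <;> simp
      linarith
    -- All points lie in `X`, so the representation pulls back to `AP X`.
    have hh : h = (s.map fun p => restrict X (of p.2 - of p.1)).sum := by
      rw [← restrict_inclusion X h, ← hs, map_multiset_sum, Multiset.map_map]
      rfl
    rw [hh]
    refine (hM.multiset_sum_le _ s).trans (Multiset.sum_map_le_sum_map _ _ fun p hp => ?_)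
    rw [map_sub, restrict_of X (hsnd p hp), restrict_of X (hfst p hp)]
    exact hMD ⟨p.1, hfst p hp⟩ ⟨p.2, hsnd p hp⟩

theorem isQuasiPStarEmbedded_of_isEmbedding [TopologicalSpace Y]
    (hemb : IsEmbedding (inclusion X)) : IsQuasiPStarEmbedded X := by
  rintro d hd ⟨C, hC⟩ hdc
  rw [hd.quasiContinuous_iff] at hdc
  -- Dividing by `K ≥ 1` makes `d` bounded by `1`.
  set K : ℝ := max C 1
  have hK : 0 < K := lt_max_of_lt_right one_pos
  have hd' : IsQuasiPseudometric fun x y => d x y / K :=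
    ⟨fun x y => div_nonneg (hd.nonneg x y) hK.le, fun x => by simp [hd.self], fun x y z => by
      rw [← add_div]
      gcongr
      exact hd.triangle x y z⟩
  have hd'1 : ∀ x y, d x y / K ≤ 1 := fun x y =>
    (div_le_one hK).2 ((hC x y).trans (le_max_left _ _))
  have hN := (isQuasiPrenorm_graev fun x y => d x y / K).min_const 1
  have hN0 : Tendsto (fun g => min (graev (fun x y => d x y / K) g) 1) (𝓝 0) (𝓝 0) :=
    tendsto_of_tendsto_of_tendsto_of_le_of_le tendsto_const_nhds
      (tendsto_graev fun x => by simpa using (hdc x).div_const K)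
      (fun _ => zero_le) fun _ => min_le_left _ _
  obtain ⟨M, hM, hM0, hNM⟩ := IsQuasiPrenorm.exists_dominating (inclusion X)
    ((isEmbedding_inclusion_iff X).1 hemb) (fun _ => min_le_right _ _) hN0
  obtain ⟨E, hE, hEM, hEN⟩ := hN.exists_extension hM (inclusion X) hNM
  have hE1 := hE.min_const 1
  have hD := hE1.isQuasiPseudometric (fun g => (min_le_right _ _).trans_lt ENNReal.one_lt_top |>.ne)
    (of : Y → AP Y)
  have hE0 : Tendsto (fun g => min (E g) 1) (𝓝 0) (𝓝 0) :=
    tendsto_of_tendsto_of_tendsto_of_le_of_le tendsto_const_nhds hM0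
      (fun _ => zero_le) fun g => (min_le_left _ _).trans (hEM g)
  have hKD : IsQuasiPseudometric fun x y : Y => K * (min (E (of y - of x)) 1).toReal :=
    ⟨fun x y => mul_nonneg hK.le (hD.nonneg x y), fun x => by rw [hD.self, mul_zero],
      fun x y z => by
        rw [← mul_add]
        exact mul_le_mul_of_nonneg_left (hD.triangle x y z) hK.le⟩
  refine ⟨_, hKD, hKD.quasiContinuous_iff.2 fun x => ?_, fun x y => ?_⟩
  · simpa using (tendsto_toReal_sub hE0 x).const_mul K
  · have e : (of (y : Y) - of (x : Y) : AP Y) = inclusion X (of y - of x) := by simp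
    rw [e, hEN, graev_sub hd', min_eq_left, min_eq_left,
      ENNReal.toReal_ofReal (hd'.nonneg x y), mul_div_cancel₀ _ hK.ne']
    all_goals simp [hd'1 x y]

theorem isEmbedding_of_isQuasiPStarEmbedded [TopologicalSpace Y] (hX : IsQuasiPStarEmbedded X) :
    IsEmbedding (inclusion X) := by
  rw [isEmbedding_inclusion_iff]
  intro U hU
  obtain ⟨M, hM, hM0, hMU⟩ := exists_isQuasiPrenorm_of_nhds (fun _ => U) fun _ => hU
  have hN := hM.min_const 1
  have hN0 : Tendsto (fun g => min (M g) 1) (𝓝 0) (𝓝 0) :=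
    tendsto_of_tendsto_of_tendsto_of_le_of_le tendsto_const_nhds hM0
      (fun _ => zero_le) fun g => min_le_left _ _
  have hfin : ∀ g, min (M g) 1 ≠ ∞ := fun g =>
    ((min_le_right _ _).trans_lt ENNReal.one_lt_top).ne
  have hd := hN.isQuasiPseudometric hfin (of : X → AP X)
  obtain ⟨D, hD, hDc, hDd⟩ := hX _ hd
    ⟨1, fun x y => ENNReal.toReal_mono ENNReal.one_ne_top (min_le_right _ _)⟩
    (hd.quasiContinuous_iff.2 (tendsto_toReal_sub hN0))
  rw [hD.quasiContinuous_iff] at hDc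
  refine mem_comap.2 ⟨_, tendsto_graev hDc (Iio_mem_nhds one_pos), fun h hh => ?_⟩
  have hle := le_graev_inclusion X hD hN
    (fun x y => by rw [hDd, ENNReal.ofReal_toReal (hfin _)]) h
  refine hMU 0 h ?_
  rw [pow_zero]
  exact (min_lt_iff.1 (hle.trans_lt hh)).resolve_right (lt_irrefl _)

end AP

theorem mainTheorem1 {Y : Type*} [TopologicalSpace Y] [T35Space Y] (X : Set Y) :
    IsEmbedding (AP.inclusion X : AP X → AP Y) ↔ IsQuasiPStarEmbedded X :=
  ⟨AP.isQuasiPStarEmbedded_of_isEmbedding X, AP.isEmbedding_of_isQuasiPStarEmbedded X⟩
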